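/- Conventions. All algebras are over $\mathbb C$, associative and unital. A unital graded differential algebra is a unital graded algebra $\Omega=\bigoplus_{n\ge 0}\Omega_n$ with a linear map $d$ of degree $1$ such that $d^2=0$ and $d(\omega'\omega)=(d\omega')\omega+(-1)^n\omega'd\omega$ for $\omega'\in\Omega_n$. It is a (unital) differential calculus over an algebra $\mathcal A$ if $\Omega_0=\mathcal A$ and every $n$-form is a sum of forms $a_0\,da_1\cdots da_n$ with $a_i\in\mathcal A$; it is $N$-dimensional if $\Omega_N\neq 0$ and $\Omega_n=0$ for $n>N$. A linear functional $\int$ on $\Omega$ is closed if $\int d=0$; $N$-dimensional if it vanishes on $\Omega_k$ for $k\ne N$; a twisted graded trace if there is an algebra automorphism $\sigma$ of $\Omega$ of degree zero with $\sigma d=d\sigma$ and $\int\omega'\omega=(-1)^{kl}\int\sigma(\omega)\omega'$ for all $k,l$, $\omega\in\Omega_k$, $\omega'\in\Omega_l$. Its left kernel is $\{\omega : \int\omega'\omega=0 \text{ for all } \omega'\in\Omega\}$. Let $\mathcal A$ be a Hopf algebra with comultiplication $\Delta$ and counit $e$. The calculus $(\Omega,d)$ is left-covariant if there is a linear map $\Delta_\Omega:\Omega\to\mathcal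 A\otimes\Omega$ with $(\Delta\otimes\mathrm{id})\Delta_\Omega=(\mathrm{id}\otimes\Delta_\Omega)\Delta_\Omega$, $(e\otimes\mathrm{id})\Delta_\Omega=\mathrm{id}$, $\Delta_\Omega(a\omega b)=\Delta(a)\Delta_\Omega(\omega)\Delta(b)$ and $\Delta_\Omega(a)=\Delta(a)$ for $a,b\in\mathcal A$, $\omega\in\Omega$, and $(\mathrm{id}\otimes d)\Delta_\Omega=\Delta_\Omega d$. A functional $\int$ on it is left-invariant if $(\mathrm{id}\otimes\int)\Delta_\Omega(\omega)=(\int\omega)1$ for all $\omega$. A Haar integral on $\mathcal A$ is a linear functional $h$ with $h(1)=1$ and $(\mathrm{id}\otimes h)\Delta(a)=h(a)1=(h\otimes\mathrm{id})\Delta(a)$ for all $a\in\mathcal A$. The universal unital calculus $(\tilde\Omega,d)$ over $\mathcal A$ is the unital graded differential algebra generated by $\mathcal A$ and the symbols $da$, linear in $a$, with $d(ab)=(da)b+a\,db$; its co-action $\Delta_{\tilde\Omega}$ is the algebra homomorphism extending $\Delta$ such that $\Delta_{\tilde\Omega}(da)=(\mathrm{id}\otimes d)\Delta(a)$ for $a\in\mathcal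 A$. Theorem 4.12. Let $\mathcal A$ be a Hopf algebra admitting a Haar integral, let $N\ge 0$, and let $\int'$ be a non-zero, $N$-dimensional, left-invariant, closed twisted graded trace on the universal unital calculus $(\tilde\Omega,d)$ over $\mathcal A$. Let $I$ be the left kernel of $\int'$, which is a two-sided ideal with $dI\subseteq I$, and let $\Omega=\tilde\Omega/I$ with the grading given by the images $\Omega_n$ of $\tilde\Omega_n$, the induced differential $d(\omega+I)=d\omega+I$ and the induced functional $\int(\omega+I)=\int'\omega$. Then $(\Omega,d)$ is an $N$-dimensional differential calculus over $\mathcal A$ and $\int$ is an $N$-dimensional closed twisted graded trace on it. Moreover, $(\Omega,d)$ is left-covariant, and $\int$ is left-invariant. -/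

import Mathlib

open scoped TensorProduct

noncomputable section

namespace NCCalculus

section Basic

variable {A Ω : Type*} [Ring A] [Algebra ℂ A] [Ring Ω] [Algebra ℂ Ω]

/-- A unital graded differential algebra over `ℂ`: an algebra `Ω = ⨁ₙ 𝒢 n` graded by `ℕ`, with a
graded derivation `d` of degree `1` such that `d² = 0`. -/
structure IsGradedDifferentialAlgebra (𝒢 : ℕ → Submodule ℂ Ω) (d : Ω →ₗ[ℂ] Ω) : Prop where
  gradedMonoid : SetLike.GradedMonoid 𝒢
  isInternal : DirectSum.IsInternal 𝒢
  d_mem : ∀ n, ∀ ω ∈ 𝒢 n, d ω ∈ 𝒢 (n + 1)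
  leibniz : ∀ n, ∀ ω' ∈ 𝒢 n, ∀ ω, d (ω' * ω) = d ω' * ω + (-1 : ℂ) ^ n • (ω' * d ω)
  d_d : ∀ ω, d (d ω) = 0

/-- A unital differential calculus over the unital algebra `A`: a unital graded differential algebra
whose algebra of `0`-forms is identified with `A` (by `ι`) and whose `n`-forms are sums of forms
`a₀ da₁ ⋯ daₙ`. -/
structure IsDifferentialCalculus (ι : A →ₐ[ℂ] Ω) (𝒢 : ℕ → Submodule ℂ Ω) (d : Ω →ₗ[ℂ] Ω) : Prop
    extends IsGradedDifferentialAlgebra 𝒢 d where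
  injective : Function.Injective ι
  range_eq : LinearMap.range ι.toLinearMap = 𝒢 0
  generated : ∀ n, 𝒢 n ≤ Submodule.span ℂ
    {ω | ∃ (a₀ : A) (a : Fin n → A), ω = ι a₀ * (List.ofFn fun i => d (ι (a i))).prod}

/-- A graded algebra `⨁ₙ 𝒢 n` has dimension `N`. -/
def HasDimension (𝒢 : ℕ → Submodule ℂ Ω) (N : ℕ) : Prop :=
  𝒢 N ≠ ⊥ ∧ ∀ n, N < n → 𝒢 n = ⊥

/-- `τ` is closed: `∫ d = 0`. -/
def IsClosedFunctional (d : Ω →ₗ[ℂ] Ω) (τ : Ω →ₗ[ℂ] ℂ) : Prop :=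
  ∀ ω, τ (d ω) = 0

/-- `τ` is `N`-dimensional: it vanishes on `k`-forms for `k ≠ N`. -/
def IsDimensional (𝒢 : ℕ → Submodule ℂ Ω) (N : ℕ) (τ : Ω →ₗ[ℂ] ℂ) : Prop :=
  ∀ k, k ≠ N → ∀ ω ∈ 𝒢 k, τ ω = 0

/-- `τ` is a twisted graded trace: there is an algebra automorphism `σ` of degree zero commuting
with `d` such that `∫ ω' ω = (-1)^(kl) ∫ σ(ω) ω'` for `ω` a `k`-form and `ω'` an `l`-form. -/
def IsTwistedGradedTrace (𝒢 : ℕ → Submodule ℂ Ω) (d : Ω →ₗ[ℂ] Ω) (τ : Ω →ₗ[ℂ] ℂ) : Prop :=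
  ∃ σ : Ω ≃ₐ[ℂ] Ω, (∀ n, ∀ ω ∈ 𝒢 n, σ ω ∈ 𝒢 n) ∧ (∀ ω, σ (d ω) = d (σ ω)) ∧
    ∀ k l, ∀ ω ∈ 𝒢 k, ∀ ω' ∈ 𝒢 l, τ (ω' * ω) = (-1 : ℂ) ^ (k * l) * τ (σ ω * ω')

/-- `τ` is an `N`-dimensional closed twisted graded trace. -/
structure IsClosedTwistedGradedTrace (𝒢 : ℕ → Submodule ℂ Ω) (d : Ω →ₗ[ℂ] Ω) (N : ℕ)
    (τ : Ω →ₗ[ℂ] ℂ) : Prop where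
  twisted : IsTwistedGradedTrace 𝒢 d τ
  closed : IsClosedFunctional d τ
  dimensional : IsDimensional 𝒢 N τ

/-- The left kernel of `τ`: the left ideal of all `ω` with `∫ ω' ω = 0` for all `ω'`. -/
def leftKernel (τ : Ω →ₗ[ℂ] ℂ) : Ideal Ω where
  carrier := {ω | ∀ ω', τ (ω' * ω) = 0}
  add_mem' := fun {x y} hx hy ω' => by rw [mul_add, map_add, hx ω', hy ω', add_zero]
  zero_mem' := fun ω' => by rw [mul_zero, map_zero]
  smul_mem' := fun c x hx ω' => by rw [smul_eq_mul, ← mul_assoc]; exact hx _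

theorem mem_leftKernel {τ : Ω →ₗ[ℂ] ℂ} {ω : Ω} : ω ∈ leftKernel τ ↔ ∀ ω', τ (ω' * ω) = 0 :=
  Iff.rfl

end Basic

section Quotient

variable {A Ω : Type*} [Ring A] [Algebra ℂ A] [Ring Ω] [Algebra ℂ Ω]
  {ι : A →ₐ[ℂ] Ω} {𝒢 : ℕ → Submodule ℂ Ω} {d : Ω →ₗ[ℂ] Ω} {N : ℕ} {τ : Ω →ₗ[ℂ] ℂ}

theorem IsGradedDifferentialAlgebra.induction (hΩ : IsGradedDifferentialAlgebra 𝒢 d)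
    {P : Ω → Prop} (hom : ∀ n, ∀ x ∈ 𝒢 n, P x) (add : ∀ x y, P x → P y → P (x + y)) (x : Ω) :
    P x := by
  have hx : x ∈ ⨆ n, 𝒢 n := by
    rw [hΩ.isInternal.submodule_iSup_eq_top]; trivial
  exact Submodule.iSup_induction 𝒢 (motive := P) hx hom (hom 0 0 (𝒢 0).zero_mem) add

theorem leftKernel_isTwoSided (hΩ : IsDifferentialCalculus ι 𝒢 d)
    (hτ : IsClosedTwistedGradedTrace 𝒢 d N τ) : (leftKernel τ).IsTwoSided := by
  have := hΩ.gradedMonoid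
  obtain ⟨⟨σ, hσ, -, h⟩, -, hN⟩ := hτ
  have key : ∀ l, ∀ ω' ∈ 𝒢 l, ∀ ω, τ (ω * ω') = (-1 : ℂ) ^ ((N - l) * l) * τ (σ ω' * ω) := by
    intro l ω' hω' ω
    induction ω using hΩ.induction with
    | add x y hx hy => rw [add_mul, map_add, hx, hy, mul_add, map_add, mul_add]
    | hom k x hx =>
      by_cases hkl : k + l = N
      · rw [h l k ω' hω' x hx, ← hkl, Nat.add_sub_cancel, mul_comm l k]
      · rw [hN (k + l) hkl _ (SetLike.mul_mem_graded hx hω'),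
          hN (l + k) (by omega) _ (SetLike.mul_mem_graded (hσ l ω' hω') hx), mul_zero]
  refine ⟨fun {x} b hx ω' => ?_⟩
  rw [← mul_assoc]
  induction b using hΩ.induction with
  | add y z hy hz => rw [mul_add, map_add, hy, hz, add_zero]
  | hom l y hy => rw [key l y hy, ← mul_assoc, hx, mul_zero]

theorem d_mem_leftKernel (hΩ : IsDifferentialCalculus ι 𝒢 d) (hτ : IsClosedTwistedGradedTrace 𝒢 d N τ)
    {ω : Ω} (hω : ω ∈ leftKernel τ) : d ω ∈ leftKernel τ := by
  intro ω'
  induction ω' using hΩ.induction with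
  | add x y hx hy => rw [add_mul, map_add, hx, hy, add_zero]
  | hom n x hx =>
    have h1 := hτ.closed (x * ω)
    rw [hΩ.leibniz n x hx, map_add, hω, zero_add, map_smul, smul_eq_mul] at h1
    exact (mul_eq_zero.mp h1).resolve_left (by simp)

/-- The space of forms of the calculus associated to a differential calculus and a twisted graded
trace on it: the quotient algebra by the left kernel. -/
def AssocForms (_hΩ : IsDifferentialCalculus ι 𝒢 d)
    (_hτ : IsClosedTwistedGradedTrace 𝒢 d N τ) : Type _ :=
  Ω ⧸ leftKernel τ

variable (hΩ : IsDifferentialCalculus ι 𝒢 d) (hτ : IsClosedTwistedGradedTrace 𝒢 d N τ)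

instance : Ring (AssocForms hΩ hτ) :=
  haveI := leftKernel_isTwoSided hΩ hτ
  inferInstanceAs (Ring (Ω ⧸ leftKernel τ))

instance : Algebra ℂ (AssocForms hΩ hτ) :=
  haveI := leftKernel_isTwoSided hΩ hτ
  inferInstanceAs (Algebra ℂ (Ω ⧸ leftKernel τ))

/-- The quotient map. -/
def assocMk : Ω →ₐ[ℂ] AssocForms hΩ hτ :=
  haveI := leftKernel_isTwoSided hΩ hτ
  Ideal.Quotient.mkₐ ℂ (leftKernel τ)

theorem assocMk_surjective : Function.Surjective (assocMk hΩ hτ) :=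
  have := leftKernel_isTwoSided hΩ hτ
  Ideal.Quotient.mk_surjective

theorem assocMk_eq_zero_iff {ω : Ω} : assocMk hΩ hτ ω = 0 ↔ ω ∈ leftKernel τ :=
  have := leftKernel_isTwoSided hΩ hτ
  Ideal.Quotient.eq_zero_iff_mem

theorem ker_assocMk :
    LinearMap.ker (assocMk hΩ hτ).toLinearMap = (leftKernel τ).restrictScalars ℂ := by
  ext ω
  exact assocMk_eq_zero_iff hΩ hτ

/-- The linear map on the quotient induced by a linear map that annihilates the left kernel. -/
def assocLift {M : Type*} [AddCommGroup M] [Module ℂ M] (f : Ω →ₗ[ℂ] M)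
    (hf : ∀ ω ∈ leftKernel τ, f ω = 0) : AssocForms hΩ hτ →ₗ[ℂ] M :=
  ((LinearMap.ker (assocMk hΩ hτ).toLinearMap).liftQ f (by
    rw [ker_assocMk]; exact fun ω hω => hf ω hω)) ∘ₗ
  ((assocMk hΩ hτ).toLinearMap.quotKerEquivOfSurjective
    (assocMk_surjective hΩ hτ)).symm.toLinearMap

@[simp] theorem assocLift_mk {M : Type*} [AddCommGroup M] [Module ℂ M] (f : Ω →ₗ[ℂ] M)
    (hf : ∀ ω ∈ leftKernel τ, f ω = 0) (ω : Ω) :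
    assocLift hΩ hτ f hf (assocMk hΩ hτ ω) = f ω := by
  have h : ((assocMk hΩ hτ).toLinearMap.quotKerEquivOfSurjective
      (assocMk_surjective hΩ hτ)).symm (assocMk hΩ hτ ω) = Submodule.Quotient.mk ω := by
    rw [LinearEquiv.symm_apply_eq]; rfl
  simp [assocLift, h]

/-- The map `A → Ω ⧸ I`, that identifies `A` with the `0`-forms of the quotient when `I ∩ A = 0`. -/
def assocIncl : A →ₐ[ℂ] AssocForms hΩ hτ := (assocMk hΩ hτ).comp ι

/-- The `n`-forms of the quotient: the image of the `n`-forms of `Ω`. -/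
def assocDeg (n : ℕ) : Submodule ℂ (AssocForms hΩ hτ) := (𝒢 n).map (assocMk hΩ hτ).toLinearMap

/-- The differential of the quotient: `d(ω + I) = dω + I`. -/
def assocD : AssocForms hΩ hτ →ₗ[ℂ] AssocForms hΩ hτ :=
  assocLift hΩ hτ ((assocMk hΩ hτ).toLinearMap ∘ₗ d) fun _ hω =>
    (assocMk_eq_zero_iff hΩ hτ).mpr (d_mem_leftKernel hΩ hτ hω)

/-- The canonical twisted graded trace on the quotient: `∫(ω + I) = ∫ω`. -/
def assocTrace : AssocForms hΩ hτ →ₗ[ℂ] ℂ :=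
  assocLift hΩ hτ τ fun ω hω => by simpa using hω 1

end Quotient

section LeftCovariant

/-- A Haar integral on a Hopf algebra: a unital, left- and right-invariant linear functional. -/
structure IsHaarIntegral {A : Type*} [Ring A] [HopfAlgebra ℂ A] (h : A →ₗ[ℂ] ℂ) : Prop where
  unital : h 1 = 1
  left_invariant : ∀ a, TensorProduct.rid ℂ A (h.lTensor A (Coalgebra.comul a)) = h a • (1 : A)
  right_invariant : ∀ a, TensorProduct.lid ℂ A (h.rTensor A (Coalgebra.comul a)) = h a • (1 : A)

variable {A Ω : Type*} [Ring A] [HopfAlgebra ℂ A] [Ring Ω] [Algebra ℂ Ω]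

/-- The comultiplication of `A` followed by the inclusion `A ⊗ A → A ⊗ Ω`. -/
def comulForms (ι : A →ₐ[ℂ] Ω) : A →ₐ[ℂ] A ⊗[ℂ] Ω :=
  (Algebra.TensorProduct.map (AlgHom.id ℂ A) ι).comp (Bialgebra.comulAlgHom ℂ A)

/-- `Δ` makes the unital differential calculus `(Ω, d)` over the Hopf algebra `A` into a
left-covariant one: it is a left co-action of `A` for which `Ω` is a left-covariant bimodule, it
extends the comultiplication of `A`, and it commutes with the differential. -/
structure IsLeftCovariant (ι : A →ₐ[ℂ] Ω) (d : Ω →ₗ[ℂ] Ω) (Δ : Ω →ₗ[ℂ] A ⊗[ℂ] Ω) : Prop where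
  coassoc : ∀ ω, TensorProduct.assoc ℂ A A Ω ((Coalgebra.comul (R := ℂ) (A := A)).rTensor Ω (Δ ω)) =
    Δ.lTensor A (Δ ω)
  counit : ∀ ω, TensorProduct.lid ℂ Ω ((Coalgebra.counit (R := ℂ) (A := A)).rTensor Ω (Δ ω)) = ω
  bimodule : ∀ a ω b, Δ (ι a * ω * ι b) = comulForms ι a * Δ ω * comulForms ι b
  extends_comul : ∀ a, Δ (ι a) = comulForms ι a
  comm_d : ∀ ω, d.lTensor A (Δ ω) = Δ (d ω)

/-- The functional `τ` is left-invariant for the co-action `Δ`: `(id ⊗ ∫) Δ(ω) = (∫ω) 1`. -/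
def IsLeftInvariant (Δ : Ω →ₗ[ℂ] A ⊗[ℂ] Ω) (τ : Ω →ₗ[ℂ] ℂ) : Prop :=
  ∀ ω, TensorProduct.rid ℂ A (τ.lTensor A (Δ ω)) = τ ω • (1 : A)

end LeftCovariant

section Universal

variable (A : Type*) [Ring A] [Algebra ℂ A]

/-- The relations of the universal unital calculus. The generator `(a, b)` stands for `a + db`. -/
inductive UniversalRel : TensorAlgebra ℂ (A × A) → TensorAlgebra ℂ (A × A) → Prop
  | one : UniversalRel (TensorAlgebra.ι ℂ (1, 0)) 1
  | mul (a b : A) : UniversalRel (TensorAlgebra.ι ℂ (a, 0) * TensorAlgebra.ι ℂ (b, 0))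
      (TensorAlgebra.ι ℂ (a * b, 0))
  | leibniz (a b : A) : UniversalRel (TensorAlgebra.ι ℂ (0, a * b))
      (TensorAlgebra.ι ℂ (0, a) * TensorAlgebra.ι ℂ (b, 0) +
        TensorAlgebra.ι ℂ (a, 0) * TensorAlgebra.ι ℂ (0, b))

/-- The algebra of forms of the universal unital calculus over `A`: the unital algebra generated by
the unital algebra `A` and symbols `da`, linear in `a ∈ A`, subject to `d(ab) = (da)b + a(db)`. -/
def UniversalForms : Type _ := RingQuot (UniversalRel A)

instance : Ring (UniversalForms A) := inferInstanceAs (Ring (RingQuot (UniversalRel A)))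

instance : Algebra ℂ (UniversalForms A) :=
  inferInstanceAs (Algebra ℂ (RingQuot (UniversalRel A)))

namespace UniversalForms

/-- The quotient map from the tensor algebra. -/
def mk : TensorAlgebra ℂ (A × A) →ₐ[ℂ] UniversalForms A := RingQuot.mkAlgHom ℂ (UniversalRel A)

/-- The inclusion of `A` as the `0`-forms. -/
def incl : A →ₐ[ℂ] UniversalForms A :=
  AlgHom.ofLinearMap
    ((mk A).toLinearMap ∘ₗ TensorAlgebra.ι ℂ ∘ₗ LinearMap.inl ℂ A A)
    (by
      have h := RingQuot.mkAlgHom_rel ℂ (UniversalRel.one (A := A))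
      rw [map_one] at h
      exact h)
    (fun a b => by
      have h := RingQuot.mkAlgHom_rel ℂ (UniversalRel.mul a b)
      rw [map_mul] at h
      exact h.symm)

/-- The generators `da`. -/
def gen : A →ₗ[ℂ] UniversalForms A :=
  (mk A).toLinearMap ∘ₗ TensorAlgebra.ι ℂ ∘ₗ LinearMap.inr ℂ A A

theorem gen_mul (a b : A) : gen A (a * b) = gen A a * incl A b + incl A a * gen A b := by
  have h := RingQuot.mkAlgHom_rel ℂ (UniversalRel.leibniz a b)
  rw [map_add, map_mul, map_mul] at h
  exact h

theorem gen_one : gen A 1 = 0 := by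
  have h := gen_mul A 1 1
  rw [mul_one, map_one (incl A), mul_one, one_mul] at h
  exact left_eq_add.mp h

variable {A}

/-- The algebra homomorphism determined by `a ↦ f a` and `da ↦ δ a`. -/
def lift {B : Type*} [Ring B] [Algebra ℂ B] (f : A →ₐ[ℂ] B) (δ : A →ₗ[ℂ] B)
    (h : ∀ a b, δ (a * b) = δ a * f b + f a * δ b) : UniversalForms A →ₐ[ℂ] B :=
  RingQuot.liftAlgHom ℂ ⟨TensorAlgebra.lift ℂ (f.toLinearMap.coprod δ), by
    intro x y hxy
    cases hxy <;> simp [h]⟩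

variable {B : Type*} [Ring B] [Algebra ℂ B] (f : A →ₐ[ℂ] B) (δ : A →ₗ[ℂ] B)
  (h : ∀ a b, δ (a * b) = δ a * f b + f a * δ b)

@[simp] theorem lift_incl (a : A) : lift f δ h (incl A a) = f a := by
  have : lift f δ h (mk A (TensorAlgebra.ι ℂ (a, 0))) = f a := by
    rw [lift, mk]
    erw [RingQuot.liftAlgHom_mkAlgHom_apply]
    simp
  exact this

@[simp] theorem lift_gen (a : A) : lift f δ h (gen A a) = δ a := by
  have : lift f δ h (mk A (TensorAlgebra.ι ℂ (0, a))) = δ a := by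
    rw [lift, mk]
    erw [RingQuot.liftAlgHom_mkAlgHom_apply]
    simp
  exact this

theorem induction {P : UniversalForms A → Prop} (scalar : ∀ c : ℂ, P (algebraMap ℂ _ c))
    (incl : ∀ a, P (incl A a)) (gen : ∀ a, P (gen A a))
    (add : ∀ x y, P x → P y → P (x + y)) (mul : ∀ x y, P x → P y → P (x * y))
    (x : UniversalForms A) : P x := by
  obtain ⟨t, rfl⟩ := RingQuot.mkAlgHom_surjective ℂ (UniversalRel A) x
  change P (mk A t)
  induction t using TensorAlgebra.induction with
  | algebraMap r => rw [AlgHom.commutes]; exact scalar r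
  | ι m =>
    have : mk A (TensorAlgebra.ι ℂ m) = UniversalForms.incl A m.1 + UniversalForms.gen A m.2 := by
      have hm : m = (m.1, 0) + (0, m.2) := by simp
      conv_lhs => rw [hm, map_add, map_add]
      rfl
    rw [this]
    exact add _ _ (incl _) (gen _)
  | add x y hx hy => rw [map_add]; exact add _ _ hx hy
  | mul x y hx hy => rw [map_mul]; exact mul _ _ hx hy

/-- The parity automorphism: `a ↦ a`, `da ↦ -da`. -/
def parity : UniversalForms A →ₐ[ℂ] UniversalForms A :=
  lift (incl A) (-gen A) fun a b => by
    simp only [LinearMap.neg_apply, gen_mul, neg_add, neg_mul, mul_neg]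

/-- The homomorphism `ω ↦ !![parity ω, dω; 0, ω]`, determined by `d(a) = da` and `d(da) = 0`. -/
def dMatrix : UniversalForms A →ₐ[ℂ] Matrix (Fin 2) (Fin 2) (UniversalForms A) :=
  lift
    (AlgHom.ofLinearMap
      { toFun := fun a => !![incl A a, gen A a; 0, incl A a]
        map_add' := fun a b => by ext i j; fin_cases i <;> fin_cases j <;> simp
        map_smul' := fun c a => by ext i j; fin_cases i <;> fin_cases j <;> simp }
      (by ext i j; fin_cases i <;> fin_cases j <;> simp [gen_one])
      (fun a b => by
        ext i j; fin_cases i <;> fin_cases j <;>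
          simp [gen_mul, add_comm]))
    { toFun := fun a => !![-gen A a, 0; 0, gen A a]
      map_add' := fun a b => by ext i j; fin_cases i <;> fin_cases j <;> simp [add_comm]
      map_smul' := fun c a => by ext i j; fin_cases i <;> fin_cases j <;> simp }
    fun a b => by
      ext i j; fin_cases i <;> fin_cases j <;>
        simp [gen_mul, add_comm]

variable (A) in
/-- The differential of the universal unital calculus. -/
def d : UniversalForms A →ₗ[ℂ] UniversalForms A :=
  LinearMap.proj (R := ℂ) (φ := fun _ : Fin 2 => UniversalForms A) 1 ∘ₗ
    LinearMap.proj (R := ℂ) (φ := fun _ : Fin 2 => Fin 2 → UniversalForms A) 0 ∘ₗ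
      (dMatrix (A := A)).toLinearMap

variable (A) in
/-- The `n`-forms: the span of the products `a₀ da₁ ⋯ daₙ`. -/
def deg (n : ℕ) : Submodule ℂ (UniversalForms A) :=
  Submodule.span ℂ {ω | ∃ (a₀ : A) (a : Fin n → A),
    ω = incl A a₀ * (List.ofFn fun i => gen A (a i)).prod}

theorem dMatrix_spec (x : UniversalForms A) :
    dMatrix x 0 0 = parity x ∧ dMatrix x 1 0 = 0 ∧ dMatrix x 1 1 = x := by
  induction x using induction with
  | scalar c => simp [Matrix.algebraMap_matrix_apply]
  | incl a => simp [dMatrix, parity]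
  | gen a => simp [dMatrix, parity]
  | add x y hx hy => simp [hx, hy]
  | mul x y hx hy => simp [Matrix.mul_apply, Fin.sum_univ_two, hx, hy]

theorem d_apply (x : UniversalForms A) : d A x = dMatrix x 0 1 := rfl

@[simp] theorem d_incl (a : A) : d A (incl A a) = gen A a := by
  simp [d_apply, dMatrix]

@[simp] theorem d_gen (a : A) : d A (gen A a) = 0 := by
  simp [d_apply, dMatrix]

theorem d_mul (x y : UniversalForms A) : d A (x * y) = d A x * y + parity x * d A y := by
  rw [d_apply, map_mul, Matrix.mul_apply, Fin.sum_univ_two, (dMatrix_spec x).1,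
    (dMatrix_spec y).2.2, d_apply, d_apply, add_comm]

@[simp] theorem d_algebraMap (c : ℂ) : d A (algebraMap ℂ _ c) = 0 := by
  rw [d_apply, AlgHom.commutes, Matrix.algebraMap_matrix_apply]
  simp

theorem d_parity (x : UniversalForms A) : d A (parity x) = -parity (d A x) := by
  induction x using induction with
  | scalar c => simp
  | incl a => simp [parity]
  | gen a => simp [parity]
  | add x y hx hy => simp [hx, hy, add_comm]
  | mul x y hx hy => simp [d_mul, hx, hy, add_comm]

theorem d_d (x : UniversalForms A) : d A (d A x) = 0 := by
  induction x using induction with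
  | scalar c => simp
  | incl a => simp
  | gen a => simp
  | add x y hx hy => simp [hx, hy]
  | mul x y hx hy => simp [d_mul, hx, hy, d_parity]

theorem deg_eq (n : ℕ) :
    deg A n = LinearMap.range (incl A).toLinearMap * LinearMap.range (gen A) ^ n := by
  have h1 : LinearMap.range (incl A).toLinearMap = Submodule.span ℂ (Set.range (incl A)) :=
    (Submodule.span_eq (LinearMap.range (incl A).toLinearMap)).symm
  have h2 : LinearMap.range (gen A) = Submodule.span ℂ (Set.range (gen A)) :=
    (Submodule.span_eq (LinearMap.range (gen A))).symm
  rw [h1, h2, Submodule.span_pow, Submodule.span_mul_span, deg]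
  congr 1
  ext ω
  constructor
  · rintro ⟨a₀, a, rfl⟩
    exact Set.mul_mem_mul ⟨a₀, rfl⟩ (Set.mem_pow.mpr ⟨fun i => ⟨_, a i, rfl⟩, rfl⟩)
  · rintro ⟨_, ⟨a₀, rfl⟩, y, hy, rfl⟩
    obtain ⟨f, rfl⟩ := Set.mem_pow.mp hy
    choose a ha using fun i => (f i).2
    exact ⟨a₀, a, by simp [ha]⟩

theorem incl_mem (a : A) : incl A a ∈ deg A 0 :=
  Submodule.subset_span ⟨a, Fin.elim0, by simp⟩

theorem gen_mem (a : A) : gen A a ∈ deg A 1 :=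
  Submodule.subset_span ⟨1, fun _ => a, by simp⟩

theorem gradedMonoid_deg : SetLike.GradedMonoid (deg A) where
  one_mem := by simpa using incl_mem (1 : A)
  mul_mem := by
    intro i j x y hx hy
    rw [deg_eq] at hx hy ⊢
    have hBB : LinearMap.range (incl A).toLinearMap * LinearMap.range (incl A).toLinearMap ≤
        LinearMap.range (incl A).toLinearMap := by
      refine Submodule.mul_le.mpr ?_
      rintro _ ⟨a, rfl⟩ _ ⟨b, rfl⟩
      exact ⟨a * b, map_mul (incl A) a b⟩
    have hEB : LinearMap.range (gen A) * LinearMap.range (incl A).toLinearMap ≤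
        LinearMap.range (incl A).toLinearMap * LinearMap.range (gen A) := by
      refine Submodule.mul_le.mpr ?_
      rintro _ ⟨a, rfl⟩ _ ⟨b, rfl⟩
      have h : gen A a * incl A b = incl A 1 * gen A (a * b) - incl A a * gen A b := by
        rw [gen_mul, map_one (incl A), one_mul, add_sub_cancel_right]
      refine (congrArg (· ∈ _) h).mpr (sub_mem ?_ ?_) <;>
        exact Submodule.mul_mem_mul ⟨_, rfl⟩ ⟨_, rfl⟩
    generalize LinearMap.range (incl A).toLinearMap = B at *
    generalize LinearMap.range (gen A) = E at *
    have hEnB : ∀ n, E ^ n * B ≤ B * E ^ n := by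
      intro n
      induction n with
      | zero => simp
      | succ n ih =>
        calc E ^ (n + 1) * B = E ^ n * (E * B) := by rw [pow_succ, mul_assoc]
          _ ≤ E ^ n * (B * E) := by gcongr
          _ = E ^ n * B * E := by rw [mul_assoc]
          _ ≤ B * E ^ n * E := by gcongr
          _ = B * E ^ (n + 1) := by rw [pow_succ, mul_assoc]
    have hle : B * E ^ i * (B * E ^ j) ≤ B * E ^ (i + j) :=
      calc B * E ^ i * (B * E ^ j) = B * (E ^ i * B) * E ^ j := by simp only [mul_assoc]
        _ ≤ B * (B * E ^ i) * E ^ j := by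
          exact mul_le_mul' (mul_le_mul' le_rfl (hEnB i)) le_rfl
        _ = B * B * E ^ (i + j) := by simp only [mul_assoc, pow_add]
        _ ≤ B * E ^ (i + j) := by gcongr
    exact hle (Submodule.mul_mem_mul hx hy)

/-- `ω ↦ ∑ₙ ωₙ Xⁿ`, where `ωₙ` is the component of degree `n` of `ω`. -/
def toPoly : UniversalForms A →ₐ[ℂ] Polynomial (UniversalForms A) :=
  lift ((Polynomial.CAlgHom (R := ℂ)).comp (incl A)) (LinearMap.restrictScalars ℂ
    (Polynomial.monomial (R := UniversalForms A) 1) ∘ₗ gen A) fun a b => by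
      change Polynomial.monomial 1 (gen A (a * b)) =
        Polynomial.monomial 1 (gen A a) * Polynomial.C (incl A b) +
          Polynomial.C (incl A a) * Polynomial.monomial 1 (gen A b)
      rw [gen_mul, Polynomial.monomial_mul_C, Polynomial.C_mul_monomial, map_add]

theorem toPoly_of_mem {n : ℕ} {ω : UniversalForms A} (hω : ω ∈ deg A n) :
    toPoly ω = Polynomial.monomial n ω := by
  induction hω using Submodule.span_induction with
  | zero => simp
  | add x y _ _ hx hy => simp [hx, hy]
  | smul c x _ hx => rw [map_smul, hx, Polynomial.smul_monomial]
  | mem x hx =>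
    obtain ⟨a₀, a, rfl⟩ := hx
    have h : ∀ (m : ℕ) (a : Fin m → A), toPoly (List.ofFn fun i => gen A (a i)).prod =
        Polynomial.monomial m (List.ofFn fun i => gen A (a i)).prod := by
      intro m
      induction m with
      | zero => intro a; simp
      | succ m ih =>
        intro a
        rw [List.ofFn_succ, List.prod_cons, map_mul, ih]
        simp [toPoly, Polynomial.monomial_mul_monomial, add_comm]
    rw [map_mul, h]
    simp [toPoly, Polynomial.C_mul_monomial]

theorem iSup_deg : ⨆ n, deg A n = ⊤ := by
  have := gradedMonoid_deg (A := A)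
  rw [eq_top_iff]
  rintro x -
  have hle : ∀ n, deg A n ≤ ⨆ n, deg A n := le_iSup (deg A)
  induction x using induction with
  | scalar c =>
    have h := hle 0 (incl_mem (algebraMap ℂ A c))
    rwa [AlgHom.commutes] at h
  | incl a => exact hle 0 (incl_mem a)
  | gen a => exact hle 1 (gen_mem a)
  | add x y hx hy => exact add_mem hx hy
  | mul x y hx hy =>
    induction hx using Submodule.iSup_induction' with
    | zero => rw [zero_mul]; exact zero_mem _
    | add u v _ _ hu hv => rw [add_mul]; exact add_mem hu hv
    | mem i u hu =>
      induction hy using Submodule.iSup_induction' with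
      | zero => rw [mul_zero]; exact zero_mem _
      | add v w _ _ hv hw => rw [mul_add]; exact add_mem hv hw
      | mem j v hv => exact hle (i + j) (SetLike.mul_mem_graded hu hv)

theorem isInternal_deg : DirectSum.IsInternal (deg A) := by
  classical
  constructor
  · rw [injective_iff_map_eq_zero]
    intro f hf
    ext n
    have h : ∀ f : DirectSum ℕ fun n => deg A n,
        (toPoly (DirectSum.coeAddMonoidHom (deg A) f)).coeff n = f n := by
      intro f
      induction f using DirectSum.induction_on with
      | zero => simp
      | of i x =>
        rw [DirectSum.coeAddMonoidHom_of, toPoly_of_mem x.2, Polynomial.coeff_monomial,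
          DirectSum.coe_of_apply]
        split_ifs <;> simp
      | add x y hx hy => simp [hx, hy]
    have hn := h f
    rw [hf] at hn
    simpa using hn.symm
  · intro x
    have hx : x ∈ ⨆ n, deg A n := by rw [iSup_deg]; trivial
    induction hx using Submodule.iSup_induction' with
    | mem i x hx => exact ⟨DirectSum.of _ i ⟨x, hx⟩, by simp⟩
    | zero => exact ⟨0, map_zero _⟩
    | add x y _ _ hx hy =>
      obtain ⟨f, rfl⟩ := hx
      obtain ⟨g, rfl⟩ := hy
      exact ⟨f + g, map_add _ _ _⟩

theorem parity_of_mem {n : ℕ} {ω : UniversalForms A} (hω : ω ∈ deg A n) :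
    parity ω = (-1 : ℂ) ^ n • ω := by
  induction hω using Submodule.span_induction with
  | zero => simp
  | add x y _ _ hx hy => simp [hx, hy]
  | smul c x _ hx => simp [hx, smul_comm c]
  | mem x hx =>
    obtain ⟨a₀, a, rfl⟩ := hx
    have h : ∀ (m : ℕ) (a : Fin m → A), parity (List.ofFn fun i => gen A (a i)).prod =
        (-1 : ℂ) ^ m • (List.ofFn fun i => gen A (a i)).prod := by
      intro m
      induction m with
      | zero => intro a; simp
      | succ m ih =>
        intro a
        rw [List.ofFn_succ, List.prod_cons, map_mul, ih]
        simp [parity, pow_succ]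
    rw [map_mul, h]
    simp [parity]

theorem d_prod (n : ℕ) (a : Fin n → A) : d A (List.ofFn fun i => gen A (a i)).prod = 0 := by
  induction n with
  | zero => simpa using d_algebraMap (A := A) 1
  | succ n ih => rw [List.ofFn_succ, List.prod_cons, d_mul, ih, d_gen]; simp

theorem d_mem {n : ℕ} {ω : UniversalForms A} (hω : ω ∈ deg A n) : d A ω ∈ deg A (n + 1) := by
  induction hω using Submodule.span_induction with
  | zero => simp
  | add x y _ _ hx hy => rw [map_add]; exact add_mem hx hy
  | smul c x _ hx => rw [map_smul]; exact Submodule.smul_mem _ _ hx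
  | mem x hx =>
    obtain ⟨a₀, a, rfl⟩ := hx
    refine Submodule.subset_span ⟨1, Fin.cons a₀ a, ?_⟩
    simp [d_mul, d_prod, List.ofFn_succ]

theorem incl_injective : Function.Injective (incl A) := by
  refine Function.LeftInverse.injective (g := lift (AlgHom.id ℂ A) 0 (by simp)) fun a => ?_
  simp

variable (A) in
/-- The universal unital calculus over `A` is a differential calculus over `A`. -/
theorem isDifferentialCalculus : IsDifferentialCalculus (incl A) (deg A) (d A) where
  gradedMonoid := gradedMonoid_deg
  isInternal := isInternal_deg
  d_mem := fun _ _ => d_mem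
  leibniz := fun n x hx y => by rw [d_mul, parity_of_mem hx, smul_mul_assoc]
  d_d := d_d
  injective := incl_injective
  range_eq := by
    rw [deg_eq, pow_zero, mul_one]
  generated := fun n => by simp only [d_incl]; exact le_refl _

end UniversalForms

end Universal

section UniversalCoaction

variable (A : Type*) [Ring A] [HopfAlgebra ℂ A]

theorem lTensor_gen_mul (x y : A ⊗[ℂ] A) :
    (UniversalForms.gen A).lTensor A (x * y) =
      (UniversalForms.gen A).lTensor A x *
        Algebra.TensorProduct.map (AlgHom.id ℂ A) (UniversalForms.incl A) y +
      Algebra.TensorProduct.map (AlgHom.id ℂ A) (UniversalForms.incl A) x *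
        (UniversalForms.gen A).lTensor A y := by
  induction x with
  | zero => simp
  | add x₁ x₂ h₁ h₂ => simp only [add_mul, map_add, h₁, h₂]; abel
  | tmul a b =>
    induction y with
    | zero => simp
    | add y₁ y₂ h₁ h₂ => simp only [mul_add, map_add, h₁, h₂]; abel
    | tmul a' b' => simp [UniversalForms.gen_mul, TensorProduct.tmul_add]

/-- The co-action `Δ` of a Hopf algebra `A` on its universal unital calculus: the algebra
homomorphism extending the comultiplication of `A` such that `Δ(da) = (id ⊗ d)Δ(a)`. -/
def universalCoaction : UniversalForms A →ₐ[ℂ] A ⊗[ℂ] UniversalForms A :=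
  UniversalForms.lift (comulForms (UniversalForms.incl A))
    ((UniversalForms.gen A).lTensor A ∘ₗ Coalgebra.comul) fun a b => by
      simp [comulForms, lTensor_gen_mul]

end UniversalCoaction

end NCCalculus

end

/-!
The quotient `Ω = Ω̃ ⧸ I` of the universal calculus by the left kernel `I` of `∫'` inherits almost all
of its structure formally. Pairing with a `k`-form only sees components of degree `N - k`, so `I` is a
graded ideal (`projection_mem_leftKernel`), which gives the grading of `Ω` and its dimension. The
twist `σ` satisfies `∫' ∘ σ = ∫'` (`trace_twist`), hence preserves `I` and descends to `Ω`.

Two points use left invariance. The first is that `Δ(I) ⊆ A ⊗ I`, so that the co-action descends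
(`slice_mem_leftKernel`). This is a consequence of strong left invariance
(`strong_left_invariance`), `ω₍₋₁₎ ∫' η ω₍₀₎ = S(η₍₋₁₎) ∫' η₍₀₎ ω`: the right-hand side vanishes for
`ω ∈ I`. The second is that `I ∩ A = 0`, i.e. that `A` embeds in `Ω` as the `0`-forms
(`assocIncl_injective`). The left ideal `J = I ∩ A` of `A` is a left coideal, by the first point.
For `a ∈ J` therefore `e(a) 1 = S(a₁) a₂ ∈ J`, and as `1 ∉ I` because `∫' ≠ 0`, the counit
vanishes on `J`; then `a = a₁ e(a₂) = 0`.
-/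

noncomputable section

namespace NCCalculus

/-! ### The grading of the quotient calculus -/

section Grading

variable {Ω : Type*} [Ring Ω] [Algebra ℂ Ω] {𝒢 : ℕ → Submodule ℂ Ω}

theorem exists_projections_of_isInternal (h𝒢 : DirectSum.IsInternal 𝒢) :
    ∃ p : ℕ → Ω →ₗ[ℂ] Ω, ∀ n k, ∀ ω ∈ 𝒢 k, p n ω = if k = n then ω else 0 := by
  classical
  let e := LinearEquiv.ofBijective (DirectSum.coeLinearMap 𝒢) h𝒢
  refine ⟨fun n => (𝒢 n).subtype ∘ₗ DirectSum.component ℂ ℕ (fun n => 𝒢 n) n ∘ₗ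
    e.symm.toLinearMap, fun n k ω hω => ?_⟩
  have he : e.symm ω = DirectSum.lof ℂ ℕ (fun n => 𝒢 n) k ⟨ω, hω⟩ := by
    rw [LinearEquiv.symm_apply_eq]
    exact (DirectSum.coeLinearMap_lof 𝒢 k ⟨ω, hω⟩).symm
  simp only [LinearMap.comp_apply, LinearEquiv.coe_coe, he, Submodule.subtype_apply,
    DirectSum.component.of]
  split_ifs with hk
  · subst hk; rfl
  · rfl

theorem isInternal_of_projections (htop : ⨆ n, 𝒢 n = ⊤) (p : ℕ → Ω →ₗ[ℂ] Ω)
    (hp : ∀ n k, ∀ ω ∈ 𝒢 k, p n ω = if k = n then ω else 0) : DirectSum.IsInternal 𝒢 := by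
  classical
  constructor
  · rw [injective_iff_map_eq_zero]
    intro f hf
    ext n
    have h : ∀ f : DirectSum ℕ fun n => 𝒢 n,
        p n (DirectSum.coeAddMonoidHom 𝒢 f) = f n := by
      intro f
      induction f using DirectSum.induction_on with
      | zero => simp
      | of i x =>
        rw [DirectSum.coeAddMonoidHom_of, hp n i x x.2, DirectSum.coe_of_apply]
        split_ifs <;> rfl
      | add x y hx hy => simp [hx, hy]
    have hn := h f
    rw [hf, map_zero] at hn
    simpa using hn.symm
  · intro x
    have hx : x ∈ ⨆ n, 𝒢 n := by rw [htop]; trivial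
    induction hx using Submodule.iSup_induction' with
    | mem i x hx => exact ⟨DirectSum.of _ i ⟨x, hx⟩, by simp⟩
    | zero => exact ⟨0, map_zero _⟩
    | add x y _ _ hx hy =>
      obtain ⟨f, rfl⟩ := hx
      obtain ⟨g, rfl⟩ := hy
      exact ⟨f + g, map_add _ _ _⟩

end Grading

section Quotient

variable {A Ω : Type*} [Ring A] [Algebra ℂ A] [Ring Ω] [Algebra ℂ Ω]
  {ι : A →ₐ[ℂ] Ω} {𝒢 : ℕ → Submodule ℂ Ω} {d : Ω →ₗ[ℂ] Ω} {N : ℕ} {τ : Ω →ₗ[ℂ] ℂ}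
  (hΩ : IsDifferentialCalculus ι 𝒢 d) (hτ : IsClosedTwistedGradedTrace 𝒢 d N τ)

@[simp] theorem assocD_mk (ω : Ω) :
    assocD hΩ hτ (assocMk hΩ hτ ω) = assocMk hΩ hτ (d ω) :=
  assocLift_mk hΩ hτ _ _ ω

@[simp] theorem assocTrace_mk (ω : Ω) : assocTrace hΩ hτ (assocMk hΩ hτ ω) = τ ω :=
  assocLift_mk hΩ hτ _ _ ω

theorem assocMk_mem_assocDeg {n : ℕ} {ω : Ω} (hω : ω ∈ 𝒢 n) :
    assocMk hΩ hτ ω ∈ assocDeg hΩ hτ n :=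
  ⟨ω, hω, rfl⟩

include hΩ hτ in
/-- The left kernel is a graded ideal: it is stable under the projections onto the homogeneous
components. -/
theorem projection_mem_leftKernel {p : ℕ → Ω →ₗ[ℂ] Ω}
    (hp : ∀ n k, ∀ ω ∈ 𝒢 k, p n ω = if k = n then ω else 0) (n : ℕ) {ω : Ω}
    (hω : ω ∈ leftKernel τ) : p n ω ∈ leftKernel τ := by
  have := hΩ.gradedMonoid
  intro η
  induction η using hΩ.induction with
  | add x y hx hy => rw [add_mul, map_add, hx, hy, add_zero]
  | hom k x hx =>
    -- Pairing with a `k`-form sees only the component of degree `N - k`.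
    have key : ∀ ω, τ (x * p n ω) = if k + n = N then τ (x * ω) else 0 := by
      intro ω
      induction ω using hΩ.induction with
      | add y z hy hz => rw [map_add, mul_add, map_add, hy, hz, mul_add, map_add]; split_ifs <;> simp
      | hom l y hy =>
        rw [hp n l y hy]
        have h0 : k + l ≠ N → τ (x * y) = 0 := fun h =>
          hτ.dimensional _ h _ (SetLike.mul_mem_graded hx hy)
        by_cases hl : l = n
        · subst hl
          by_cases hk : k + l = N <;> simp [hk, h0]
        · by_cases hk : k + n = N
          · rw [if_neg hl, if_pos hk, mul_zero, map_zero, h0 (by omega)]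
          · simp [hl, hk]
    rw [key, hω x, ite_self]

theorem iSup_assocDeg : ⨆ n, assocDeg hΩ hτ n = ⊤ := by
  simp only [assocDeg]
  rw [← Submodule.map_iSup, hΩ.isInternal.submodule_iSup_eq_top, Submodule.map_top,
    LinearMap.range_eq_top]
  exact assocMk_surjective hΩ hτ

theorem isInternal_assocDeg : DirectSum.IsInternal (assocDeg hΩ hτ) := by
  obtain ⟨p, hp⟩ := exists_projections_of_isInternal hΩ.isInternal
  refine isInternal_of_projections (iSup_assocDeg hΩ hτ)
    (fun n => assocLift hΩ hτ ((assocMk hΩ hτ).toLinearMap ∘ₗ p n) fun ω hω =>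
      (assocMk_eq_zero_iff hΩ hτ).mpr (projection_mem_leftKernel hΩ hτ hp n hω)) ?_
  rintro n k _ ⟨ω, hω, rfl⟩
  refine (assocLift_mk hΩ hτ _ _ ω).trans ?_
  rw [LinearMap.comp_apply, hp n k ω hω, AlgHom.toLinearMap_apply]
  split_ifs <;> simp

theorem isGradedDifferentialAlgebra_assoc :
    IsGradedDifferentialAlgebra (assocDeg hΩ hτ) (assocD hΩ hτ) where
  gradedMonoid :=
    have := hΩ.gradedMonoid
    { one_mem := ⟨1, SetLike.one_mem_graded 𝒢, map_one (assocMk hΩ hτ)⟩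
      mul_mem := by
        rintro i j _ _ ⟨x, hx, rfl⟩ ⟨y, hy, rfl⟩
        exact ⟨x * y, SetLike.mul_mem_graded hx hy, map_mul (assocMk hΩ hτ) x y⟩ }
  isInternal := isInternal_assocDeg hΩ hτ
  d_mem := by
    rintro n _ ⟨x, hx, rfl⟩
    exact ⟨d x, hΩ.d_mem n x hx, (assocD_mk hΩ hτ x).symm⟩
  leibniz := by
    rintro n _ ⟨x, hx, rfl⟩ y
    obtain ⟨y, rfl⟩ := assocMk_surjective hΩ hτ y
    simp only [AlgHom.toLinearMap_apply, ← map_mul, assocD_mk, hΩ.leibniz n x hx, map_add, map_smul]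
  d_d := by
    intro x
    obtain ⟨x, rfl⟩ := assocMk_surjective hΩ hτ x
    rw [assocD_mk, assocD_mk, hΩ.d_d, map_zero]

/-- The quotient by the left kernel is a differential calculus over `A` as soon as no non-zero
element of `A` lies in the left kernel. -/
theorem isDifferentialCalculus_assoc (hinj : Function.Injective (assocIncl hΩ hτ)) :
    IsDifferentialCalculus (assocIncl hΩ hτ) (assocDeg hΩ hτ) (assocD hΩ hτ) where
  toIsGradedDifferentialAlgebra := isGradedDifferentialAlgebra_assoc hΩ hτ
  injective := hinj
  range_eq := by
    rw [assocDeg, ← hΩ.range_eq, ← LinearMap.range_comp]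
    rfl
  generated := by
    intro n
    refine (Submodule.map_mono (hΩ.generated n)).trans ?_
    rw [Submodule.map_span]
    refine Submodule.span_mono ?_
    rintro _ ⟨_, ⟨a₀, a, rfl⟩, rfl⟩
    refine ⟨a₀, a, ?_⟩
    simp [assocIncl, map_list_prod, List.map_ofFn, Function.comp_def]

theorem hasDimension_assoc (hne : τ ≠ 0) : HasDimension (assocDeg hΩ hτ) N := by
  have := hΩ.gradedMonoid
  constructor
  · intro hbot
    refine hne (LinearMap.ext fun ω => ?_)
    induction ω using hΩ.induction with
    | add x y hx hy => rw [map_add, map_add, hx, hy]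
    | hom k x hx =>
      by_cases hk : k = N
      · subst hk
        have h := assocMk_mem_assocDeg hΩ hτ hx
        rw [hbot, Submodule.mem_bot, assocMk_eq_zero_iff] at h
        simpa using h 1
      · exact hτ.dimensional k hk x hx
  · intro n hn
    rw [eq_bot_iff]
    rintro _ ⟨x, hx, rfl⟩
    refine (assocMk_eq_zero_iff hΩ hτ).mpr fun η => ?_
    induction η using hΩ.induction with
    | add y z hy hz => rw [add_mul, map_add, hy, hz, add_zero]
    | hom k y hy => exact hτ.dimensional (k + n) (by omega) _ (SetLike.mul_mem_graded hy hx)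

/-! ### The trace on the quotient calculus -/

include hΩ in
/-- A twisted graded trace is invariant under its twist: take `ω' = 1` in the trace property. -/
theorem trace_twist {σ : Ω ≃ₐ[ℂ] Ω}
    (h : ∀ k l, ∀ ω ∈ 𝒢 k, ∀ ω' ∈ 𝒢 l, τ (ω' * ω) = (-1 : ℂ) ^ (k * l) * τ (σ ω * ω')) (ω : Ω) :
    τ (σ ω) = τ ω := by
  have := hΩ.gradedMonoid
  induction ω using hΩ.induction with
  | add x y hx hy => rw [map_add, map_add, map_add, hx, hy]
  | hom k x hx => simpa using (h k 0 x hx 1 (SetLike.one_mem_graded 𝒢)).symm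

theorem map_mem_leftKernel_iff {σ : Ω ≃ₐ[ℂ] Ω} (h : ∀ ω, τ (σ ω) = τ ω) {ω : Ω} :
    σ ω ∈ leftKernel τ ↔ ω ∈ leftKernel τ := by
  simp only [mem_leftKernel]
  refine σ.surjective.forall.trans (forall_congr' fun η => ?_)
  rw [← map_mul, h]

/-- The automorphism of the quotient induced by an automorphism preserving `∫`. -/
def assocEquiv (σ : Ω ≃ₐ[ℂ] Ω) (h : ∀ ω, τ (σ ω) = τ ω) :
    AssocForms hΩ hτ ≃ₐ[ℂ] AssocForms hΩ hτ :=
  haveI := leftKernel_isTwoSided hΩ hτ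
  Ideal.quotientEquivAlg (leftKernel τ) (leftKernel τ) σ (by
    ext ω
    obtain ⟨ω, rfl⟩ := σ.surjective ω
    rw [map_mem_leftKernel_iff h]
    refine ⟨fun hω => Ideal.mem_map_of_mem _ hω, fun hω => ?_⟩
    obtain ⟨x, hx, hxω⟩ := (Ideal.mem_map_iff_of_surjective (σ : Ω →+* Ω) σ.surjective).mp hω
    rwa [← σ.injective hxω])

@[simp] theorem assocEquiv_mk (σ : Ω ≃ₐ[ℂ] Ω) (h : ∀ ω, τ (σ ω) = τ ω) (ω : Ω) :
    assocEquiv hΩ hτ σ h (assocMk hΩ hτ ω) = assocMk hΩ hτ (σ ω) :=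
  rfl

theorem isClosedTwistedGradedTrace_assoc :
    IsClosedTwistedGradedTrace (assocDeg hΩ hτ) (assocD hΩ hτ) N (assocTrace hΩ hτ) where
  twisted := by
    obtain ⟨σ, hσ, hd, h⟩ := hτ.twisted
    refine ⟨assocEquiv hΩ hτ σ (trace_twist hΩ h), ?_, ?_, ?_⟩
    · rintro n _ ⟨x, hx, rfl⟩
      exact ⟨σ x, hσ n x hx, rfl⟩
    · intro x
      obtain ⟨x, rfl⟩ := assocMk_surjective hΩ hτ x
      simp [hd]
    · rintro k l _ ⟨x, hx, rfl⟩ _ ⟨y, hy, rfl⟩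
      simp only [AlgHom.toLinearMap_apply, assocEquiv_mk, ← map_mul, assocTrace_mk]
      exact h k l x hx y hy
  closed := by
    intro x
    obtain ⟨x, rfl⟩ := assocMk_surjective hΩ hτ x
    rw [assocD_mk, assocTrace_mk, hτ.closed]
  dimensional := by
    rintro k hk _ ⟨x, hx, rfl⟩
    exact (assocTrace_mk hΩ hτ x).trans (hτ.dimensional k hk x hx)

end Quotient

/-! ### Slices of tensors -/

section Tensor

variable {A M M' : Type*} [AddCommGroup A] [Module ℂ A] [AddCommGroup M] [Module ℂ M]
  [AddCommGroup M'] [Module ℂ M']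

/-- Slicing by functionals on the left factor separates the points of `A ⊗ M`. -/
theorem tensor_eq_zero_of_slices (x : A ⊗[ℂ] M)
    (hx : ∀ f : A →ₗ[ℂ] ℂ, TensorProduct.lid ℂ M (f.rTensor M x) = 0) : x = 0 := by
  classical
  let b := Module.Basis.ofVectorSpace ℂ A
  have key : ∀ i (y : A ⊗[ℂ] M), TensorProduct.equivFinsuppOfBasisLeft (N := M) b y i =
      TensorProduct.lid ℂ M ((b.coord i).rTensor M y) := by
    intro i y
    induction y with
    | zero => simp
    | add y z hy hz => simp [hy, hz]
    | tmul a m => simp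
  apply (TensorProduct.equivFinsuppOfBasisLeft (N := M) b).injective
  ext i
  rw [key, hx, map_zero, Finsupp.zero_apply]

theorem lid_rTensor_lTensor (f : A →ₗ[ℂ] ℂ) (g : M →ₗ[ℂ] M') (x : A ⊗[ℂ] M) :
    TensorProduct.lid ℂ M' (f.rTensor M' (g.lTensor A x)) =
      g (TensorProduct.lid ℂ M (f.rTensor M x)) := by
  induction x with
  | zero => simp
  | add x y hx hy => simp only [map_add, hx, hy]
  | tmul a m => simp

theorem assoc_rTensor_lTensor (Δ : A →ₗ[ℂ] A ⊗[ℂ] A) (g : M →ₗ[ℂ] M') (x : A ⊗[ℂ] M) :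
    TensorProduct.assoc ℂ A A M' (Δ.rTensor M' (g.lTensor A x)) =
      (g.lTensor A).lTensor A (TensorProduct.assoc ℂ A A M (Δ.rTensor M x)) := by
  induction x with
  | zero => simp
  | add x y hx hy => simp only [map_add, hx, hy]
  | tmul a m =>
    simp only [LinearMap.lTensor_tmul, LinearMap.rTensor_tmul]
    induction Δ a with
    | zero => simp
    | add x y hx hy => simp only [TensorProduct.add_tmul, map_add, hx, hy]
    | tmul b c => simp

end Tensor

/-! ### The universal calculus is left-covariant -/

section UniversalCoaction

variable {A : Type*} [Ring A] [HopfAlgebra ℂ A]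

theorem UniversalForms.algHom_ext {A B : Type*} [Ring A] [Algebra ℂ A] [Ring B] [Algebra ℂ B]
    {f g : UniversalForms A →ₐ[ℂ] B} (hincl : ∀ a, f (incl A a) = g (incl A a))
    (hgen : ∀ a, f (gen A a) = g (gen A a)) : f = g := by
  ext x
  induction x using UniversalForms.induction with
  | scalar c => simp
  | incl a => exact hincl a
  | gen a => exact hgen a
  | add x y hx hy => rw [map_add, map_add, hx, hy]
  | mul x y hx hy => rw [map_mul, map_mul, hx, hy]

theorem universalCoaction_incl (a : A) :
    universalCoaction A (UniversalForms.incl A a) =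
      (UniversalForms.incl A).toLinearMap.lTensor A (Coalgebra.comul a) :=
  UniversalForms.lift_incl _ _ _ a

theorem universalCoaction_gen (a : A) :
    universalCoaction A (UniversalForms.gen A a) =
      (UniversalForms.gen A).lTensor A (Coalgebra.comul a) :=
  UniversalForms.lift_gen _ _ _ a

section Comodule

variable {M : Type*} [AddCommGroup M] [Module ℂ M] {Δ : M →ₗ[ℂ] A ⊗[ℂ] M} {g : A →ₗ[ℂ] M}
  (hg : ∀ a, Δ (g a) = g.lTensor A (Coalgebra.comul a))
include hg

/-- A map intertwining `Δ` with the comultiplication transports coassociativity. -/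
theorem coassoc_of_intertwines (a : A) :
    TensorProduct.assoc ℂ A A M ((Coalgebra.comul (R := ℂ) (A := A)).rTensor M (Δ (g a))) =
      Δ.lTensor A (Δ (g a)) := by
  have h : Δ ∘ₗ g = g.lTensor A ∘ₗ Coalgebra.comul := LinearMap.ext hg
  rw [hg, assoc_rTensor_lTensor, Coalgebra.coassoc_apply, ← LinearMap.lTensor_comp_apply,
    ← LinearMap.lTensor_comp_apply, h]

/-- A map intertwining `Δ` with the comultiplication transports the counit axiom. -/
theorem counit_of_intertwines (a : A) :
    TensorProduct.lid ℂ M ((Coalgebra.counit (R := ℂ) (A := A)).rTensor M (Δ (g a))) = g a := by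
  rw [hg, lid_rTensor_lTensor, Coalgebra.rTensor_counit_comul, TensorProduct.lid_tmul, one_smul]

end Comodule

theorem universalCoaction_coassoc (ω : UniversalForms A) :
    TensorProduct.assoc ℂ A A _
        ((Coalgebra.comul (R := ℂ) (A := A)).rTensor _ (universalCoaction A ω)) =
      (universalCoaction A).toLinearMap.lTensor A (universalCoaction A ω) := by
  have h : ((Algebra.TensorProduct.assoc ℂ ℂ ℂ A A (UniversalForms A)).toAlgHom.comp
      (Algebra.TensorProduct.map (Bialgebra.comulAlgHom ℂ A) (AlgHom.id ℂ _))).comp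
        (universalCoaction A) =
      (Algebra.TensorProduct.map (AlgHom.id ℂ A) (universalCoaction A)).comp
        (universalCoaction A) :=
    UniversalForms.algHom_ext
      (coassoc_of_intertwines (Δ := (universalCoaction A).toLinearMap)
        (g := (UniversalForms.incl A).toLinearMap) universalCoaction_incl)
      (coassoc_of_intertwines (Δ := (universalCoaction A).toLinearMap) universalCoaction_gen)
  exact DFunLike.congr_fun h ω

theorem universalCoaction_counit (ω : UniversalForms A) :
    TensorProduct.lid ℂ _
      ((Coalgebra.counit (R := ℂ) (A := A)).rTensor _ (universalCoaction A ω)) = ω := by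
  have h : ((Algebra.TensorProduct.lid ℂ (UniversalForms A)).toAlgHom.comp
      (Algebra.TensorProduct.map (Bialgebra.counitAlgHom ℂ A) (AlgHom.id ℂ _))).comp
        (universalCoaction A) = AlgHom.id ℂ _ :=
    UniversalForms.algHom_ext
      (counit_of_intertwines (Δ := (universalCoaction A).toLinearMap)
        (g := (UniversalForms.incl A).toLinearMap) universalCoaction_incl)
      (counit_of_intertwines (Δ := (universalCoaction A).toLinearMap) universalCoaction_gen)
  exact DFunLike.congr_fun h ω

theorem universalCoaction_parity (ω : UniversalForms A) :
    universalCoaction A (UniversalForms.parity ω) =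
      Algebra.TensorProduct.map (AlgHom.id ℂ A) UniversalForms.parity (universalCoaction A ω) := by
  have h : (universalCoaction A).comp UniversalForms.parity =
      (Algebra.TensorProduct.map (AlgHom.id ℂ A) UniversalForms.parity).comp
        (universalCoaction A) := by
    refine UniversalForms.algHom_ext (fun a => ?_) fun a => ?_
    · simp only [AlgHom.comp_apply, UniversalForms.parity, UniversalForms.lift_incl,
        universalCoaction_incl]
      induction Coalgebra.comul (R := ℂ) a with
      | zero => simp
      | add x y hx hy => simp only [map_add]; rw [← hx, ← hy]
      | tmul b c => simp
    · simp only [AlgHom.comp_apply, UniversalForms.parity, UniversalForms.lift_gen,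
        LinearMap.neg_apply, map_neg, universalCoaction_gen]
      induction Coalgebra.comul (R := ℂ) a with
      | zero => simp
      | add x y hx hy => simp only [map_add, neg_add]; rw [← hx, ← hy]
      | tmul b c => simp [TensorProduct.tmul_neg]
  exact DFunLike.congr_fun h ω

theorem lTensor_d_mul (x y : A ⊗[ℂ] UniversalForms A) :
    (UniversalForms.d A).lTensor A (x * y) =
      (UniversalForms.d A).lTensor A x * y +
        Algebra.TensorProduct.map (AlgHom.id ℂ A) UniversalForms.parity x *
          (UniversalForms.d A).lTensor A y := by
  induction x with
  | zero => simp
  | add x₁ x₂ h₁ h₂ => simp only [add_mul, map_add, h₁, h₂]; abel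
  | tmul a b =>
    induction y with
    | zero => simp
    | add y₁ y₂ h₁ h₂ => simp only [mul_add, map_add, h₁, h₂]; abel
    | tmul a' b' => simp [UniversalForms.d_mul, TensorProduct.tmul_add]

theorem universalCoaction_d (ω : UniversalForms A) :
    (UniversalForms.d A).lTensor A (universalCoaction A ω) =
      universalCoaction A (UniversalForms.d A ω) := by
  induction ω using UniversalForms.induction with
  | scalar c =>
    have h : UniversalForms.d A 1 = 0 := by
      simpa using UniversalForms.d_algebraMap (A := A) 1
    rw [AlgHom.commutes, Algebra.algebraMap_eq_smul_one, map_smul,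
      Algebra.TensorProduct.one_def, LinearMap.lTensor_tmul, h]
    simp
  | incl a =>
    rw [UniversalForms.d_incl, universalCoaction_gen, universalCoaction_incl,
      ← LinearMap.lTensor_comp_apply]
    congr 2
    ext a
    simp
  | gen a =>
    have h : UniversalForms.d A ∘ₗ UniversalForms.gen A = 0 := by ext a; simp
    rw [UniversalForms.d_gen, universalCoaction_gen, ← LinearMap.lTensor_comp_apply, h]
    simp
  | add x y hx hy => simp only [map_add, hx, hy]
  | mul x y hx hy =>
    rw [map_mul, lTensor_d_mul, hx, hy, UniversalForms.d_mul, map_add, map_mul, map_mul,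
      universalCoaction_parity]

variable (A) in
theorem isLeftCovariant_universalCoaction :
    IsLeftCovariant (UniversalForms.incl A) (UniversalForms.d A)
      (universalCoaction A).toLinearMap where
  coassoc := universalCoaction_coassoc
  counit := universalCoaction_counit
  bimodule a ω b := by
    simp only [AlgHom.toLinearMap_apply, map_mul]
    rw [universalCoaction_incl, universalCoaction_incl]
    rfl
  extends_comul := universalCoaction_incl
  comm_d := universalCoaction_d

end UniversalCoaction

/-! ### The left kernel of a left-invariant functional -/

section LeftKernel

variable {A Ω : Type*} [Ring A] [HopfAlgebra ℂ A] [Ring Ω] [Algebra ℂ Ω]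
  {ι : A →ₐ[ℂ] Ω} {d : Ω →ₗ[ℂ] Ω} {Δ : Ω →ₐ[ℂ] A ⊗[ℂ] Ω} {τ : Ω →ₗ[ℂ] ℂ}

theorem rid_lTensor_tmul_mul (a : A) (η : Ω) (y : A ⊗[ℂ] Ω) :
    TensorProduct.rid ℂ A (τ.lTensor A ((a ⊗ₜ[ℂ] η) * y)) =
      a * TensorProduct.rid ℂ A (τ.lTensor A ((1 ⊗ₜ[ℂ] η) * y)) := by
  induction y with
  | zero => simp
  | add x y hx hy => simp only [mul_add, map_add, hx, hy]
  | tmul b θ => simp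

/-- The linear map `a ⊗ x ↦ S(a) (id ⊗ ∫)(x y)`. -/
def antipodeSlice (τ : Ω →ₗ[ℂ] ℂ) (y : A ⊗[ℂ] Ω) : A ⊗[ℂ] (A ⊗[ℂ] Ω) →ₗ[ℂ] A :=
  LinearMap.mul' ℂ A ∘ₗ TensorProduct.map (HopfAlgebra.antipode ℂ)
    ((TensorProduct.rid ℂ A).toLinearMap ∘ₗ τ.lTensor A ∘ₗ LinearMap.mulRight ℂ y)

theorem antipodeSlice_tmul (y : A ⊗[ℂ] Ω) (a : A) (x : A ⊗[ℂ] Ω) :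
    antipodeSlice τ y (a ⊗ₜ x) =
      HopfAlgebra.antipode ℂ a * TensorProduct.rid ℂ A (τ.lTensor A (x * y)) :=
  rfl

theorem antipodeSlice_assoc_comul (y z : A ⊗[ℂ] Ω) :
    antipodeSlice τ y (TensorProduct.assoc ℂ A A Ω
        ((Coalgebra.comul (R := ℂ) (A := A)).rTensor Ω z)) =
      TensorProduct.rid ℂ A (τ.lTensor A ((1 ⊗ₜ[ℂ] TensorProduct.lid ℂ Ω
        ((Coalgebra.counit (R := ℂ) (A := A)).rTensor Ω z)) * y)) := by
  induction z with
  | zero => simp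
  | add x y hx hy => simp only [map_add, hx, hy, TensorProduct.tmul_add, add_mul]
  | tmul a η =>
    have h : ∀ c : A ⊗[ℂ] A, antipodeSlice τ y (TensorProduct.assoc ℂ A A Ω (c ⊗ₜ η)) =
        LinearMap.mul' ℂ A ((HopfAlgebra.antipode ℂ).rTensor A c) *
          TensorProduct.rid ℂ A (τ.lTensor A ((1 ⊗ₜ[ℂ] η) * y)) := by
      intro c
      induction c with
      | zero => simp
      | add c c' hc hc' => simp only [TensorProduct.add_tmul, map_add, hc, hc', add_mul]
      | tmul b b' =>
        rw [TensorProduct.assoc_tmul, antipodeSlice_tmul, rid_lTensor_tmul_mul, ← mul_assoc]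
        simp
    rw [LinearMap.rTensor_tmul, h, HopfAlgebra.mul_antipode_rTensor_comul_apply,
      LinearMap.rTensor_tmul, TensorProduct.lid_tmul, TensorProduct.tmul_smul, smul_mul_assoc,
      map_smul, map_smul, Algebra.smul_def]

/-- Strong left invariance, `ω₍₋₁₎ ∫ η ω₍₀₎ = S(η₍₋₁₎) ∫ η₍₀₎ ω`, which follows from left
invariance by the antipode axiom. -/
theorem strong_left_invariance (hΔ : IsLeftCovariant ι d Δ.toLinearMap)
    (hinv : IsLeftInvariant Δ.toLinearMap τ) (η ω : Ω) :
    TensorProduct.rid ℂ A (τ.lTensor A ((1 ⊗ₜ[ℂ] η) * Δ ω)) =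
      LinearMap.mul' ℂ A (TensorProduct.map (HopfAlgebra.antipode ℂ)
        (Algebra.linearMap ℂ A ∘ₗ τ ∘ₗ LinearMap.mulRight ℂ ω) (Δ η)) := by
  have hcounit := hΔ.counit η
  have hcoassoc := hΔ.coassoc η
  simp only [AlgHom.toLinearMap_apply] at hcounit hcoassoc
  rw [← hcounit, ← antipodeSlice_assoc_comul, hcoassoc, hcounit]
  induction Δ η with
  | zero => simp
  | add x y hx hy => simp only [map_add, hx, hy]
  | tmul a θ =>
    have h := hinv (θ * ω)
    simp only [AlgHom.toLinearMap_apply, map_mul] at h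
    rw [LinearMap.lTensor_tmul, antipodeSlice_tmul, AlgHom.toLinearMap_apply, h]
    simp [Algebra.smul_def]

/-- The left kernel of a left-invariant functional is a left subcomodule: slices of its co-action
remain in it. -/
theorem slice_mem_leftKernel (hΔ : IsLeftCovariant ι d Δ.toLinearMap)
    (hinv : IsLeftInvariant Δ.toLinearMap τ) {ω : Ω} (hω : ω ∈ leftKernel τ) (f : A →ₗ[ℂ] ℂ) :
    TensorProduct.lid ℂ Ω (f.rTensor Ω (Δ ω)) ∈ leftKernel τ := by
  intro η
  have hslice : ∀ x : A ⊗[ℂ] Ω, τ (η * TensorProduct.lid ℂ Ω (f.rTensor Ω x)) =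
      f (TensorProduct.rid ℂ A (τ.lTensor A ((1 ⊗ₜ[ℂ] η) * x))) := by
    intro x
    induction x with
    | zero => simp
    | add x y hx hy => simp only [mul_add, map_add, hx, hy]
    | tmul a θ => simp [mul_comm]
  have h0 : τ ∘ₗ LinearMap.mulRight ℂ ω = 0 := LinearMap.ext hω
  rw [hslice, strong_left_invariance hΔ hinv, h0]
  simp

end LeftKernel

/-! ### The co-action on the quotient calculus -/

section Quotient

variable {A Ω : Type*} [Ring A] [HopfAlgebra ℂ A] [Ring Ω] [Algebra ℂ Ω]
  {ι : A →ₐ[ℂ] Ω} {𝒢 : ℕ → Submodule ℂ Ω} {d : Ω →ₗ[ℂ] Ω} {N : ℕ} {τ : Ω →ₗ[ℂ] ℂ}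
  {Δ : Ω →ₐ[ℂ] A ⊗[ℂ] Ω}
  (hΩ : IsDifferentialCalculus ι 𝒢 d) (hτ : IsClosedTwistedGradedTrace 𝒢 d N τ)
  (hΔ : IsLeftCovariant ι d Δ.toLinearMap) (hinv : IsLeftInvariant Δ.toLinearMap τ)

/-- The co-action on the quotient by the left kernel: `ω + I ↦ (id ⊗ π) Δ(ω)`, where `π` is the
quotient map. -/
def assocCoaction : AssocForms hΩ hτ →ₗ[ℂ] A ⊗[ℂ] AssocForms hΩ hτ :=
  assocLift hΩ hτ ((assocMk hΩ hτ).toLinearMap.lTensor A ∘ₗ Δ.toLinearMap) fun ω hω =>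
    tensor_eq_zero_of_slices _ fun f => by
      rw [LinearMap.comp_apply, lid_rTensor_lTensor]
      exact (assocMk_eq_zero_iff hΩ hτ).mpr (slice_mem_leftKernel hΔ hinv hω f)

@[simp] theorem assocCoaction_mk (ω : Ω) :
    assocCoaction hΩ hτ hΔ hinv (assocMk hΩ hτ ω) =
      (assocMk hΩ hτ).toLinearMap.lTensor A (Δ ω) :=
  assocLift_mk hΩ hτ _ _ ω

theorem assocCoaction_comp_mk :
    assocCoaction hΩ hτ hΔ hinv ∘ₗ (assocMk hΩ hτ).toLinearMap =
      (assocMk hΩ hτ).toLinearMap.lTensor A ∘ₗ Δ.toLinearMap :=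
  LinearMap.ext (assocCoaction_mk hΩ hτ hΔ hinv)

theorem lTensor_assocMk_comulForms (a : A) :
    (assocMk hΩ hτ).toLinearMap.lTensor A (comulForms ι a) = comulForms (assocIncl hΩ hτ) a := by
  change (assocMk hΩ hτ).toLinearMap.lTensor A (ι.toLinearMap.lTensor A (Coalgebra.comul a)) =
    (assocIncl hΩ hτ).toLinearMap.lTensor A (Coalgebra.comul a)
  rw [← LinearMap.lTensor_comp_apply]
  rfl

theorem lTensor_assocMk_mul (x y : A ⊗[ℂ] Ω) :
    (assocMk hΩ hτ).toLinearMap.lTensor A (x * y) =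
      (assocMk hΩ hτ).toLinearMap.lTensor A x * (assocMk hΩ hτ).toLinearMap.lTensor A y :=
  map_mul (Algebra.TensorProduct.map (AlgHom.id ℂ A) (assocMk hΩ hτ)) x y

theorem isLeftCovariant_assocCoaction :
    IsLeftCovariant (assocIncl hΩ hτ) (assocD hΩ hτ) (assocCoaction hΩ hτ hΔ hinv) where
  coassoc x := by
    obtain ⟨ω, rfl⟩ := assocMk_surjective hΩ hτ x
    have h := hΔ.coassoc ω
    simp only [AlgHom.toLinearMap_apply] at h
    rw [assocCoaction_mk, assoc_rTensor_lTensor, h, ← LinearMap.lTensor_comp_apply,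
      ← LinearMap.lTensor_comp_apply, assocCoaction_comp_mk]
  counit x := by
    obtain ⟨ω, rfl⟩ := assocMk_surjective hΩ hτ x
    rw [assocCoaction_mk, lid_rTensor_lTensor]
    exact congrArg (assocMk hΩ hτ) (hΔ.counit ω)
  bimodule a x b := by
    obtain ⟨ω, rfl⟩ := assocMk_surjective hΩ hτ x
    have h := hΔ.bimodule a ω b
    simp only [AlgHom.toLinearMap_apply] at h
    change assocCoaction hΩ hτ hΔ hinv
      (assocMk hΩ hτ (ι a) * assocMk hΩ hτ ω * assocMk hΩ hτ (ι b)) = _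
    rw [← map_mul, ← map_mul, assocCoaction_mk, h, lTensor_assocMk_mul, lTensor_assocMk_mul,
      lTensor_assocMk_comulForms, lTensor_assocMk_comulForms, assocCoaction_mk]
  extends_comul a := by
    rw [← lTensor_assocMk_comulForms, ← hΔ.extends_comul]
    exact assocCoaction_mk hΩ hτ hΔ hinv (ι a)
  comm_d x := by
    obtain ⟨ω, rfl⟩ := assocMk_surjective hΩ hτ x
    have h := hΔ.comm_d ω
    simp only [AlgHom.toLinearMap_apply] at h
    have hd : assocD hΩ hτ ∘ₗ (assocMk hΩ hτ).toLinearMap = (assocMk hΩ hτ).toLinearMap ∘ₗ d :=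
      LinearMap.ext (assocD_mk hΩ hτ)
    rw [assocD_mk, assocCoaction_mk, assocCoaction_mk, ← h, ← LinearMap.lTensor_comp_apply,
      ← LinearMap.lTensor_comp_apply, hd]

theorem isLeftInvariant_assocTrace :
    IsLeftInvariant (assocCoaction hΩ hτ hΔ hinv) (assocTrace hΩ hτ) := by
  intro x
  obtain ⟨ω, rfl⟩ := assocMk_surjective hΩ hτ x
  have h : assocTrace hΩ hτ ∘ₗ (assocMk hΩ hτ).toLinearMap = τ :=
    LinearMap.ext (assocTrace_mk hΩ hτ)
  rw [assocCoaction_mk, ← LinearMap.lTensor_comp_apply, h, assocTrace_mk]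
  exact hinv ω

include hΔ hinv in
theorem lTensor_assocIncl_comul_eq_zero {a : A} (ha : assocIncl hΩ hτ a = 0) :
    (assocIncl hΩ hτ).toLinearMap.lTensor A (Coalgebra.comul a) = 0 := by
  have h := (isLeftCovariant_assocCoaction hΩ hτ hΔ hinv).extends_comul a
  rw [ha, map_zero] at h
  exact h.symm

include hΔ hinv in
/-- The counit vanishes on `I ∩ A`: for `a` in it, `e(a) 1 = S(a₁) a₂` lies in `I`, and `1 ∉ I`. -/
theorem counit_eq_zero_of_assocIncl_eq_zero (hne : τ ≠ 0) {a : A} (ha : assocIncl hΩ hτ a = 0) :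
    Coalgebra.counit (R := ℂ) a = 0 := by
  have hmul : ∀ x : A ⊗[ℂ] A,
      assocIncl hΩ hτ (LinearMap.mul' ℂ A ((HopfAlgebra.antipode ℂ).rTensor A x)) =
        LinearMap.mul' ℂ _ (((assocIncl hΩ hτ).toLinearMap ∘ₗ HopfAlgebra.antipode ℂ).rTensor _
          ((assocIncl hΩ hτ).toLinearMap.lTensor A x)) := by
    intro x
    induction x with
    | zero => simp
    | add x y hx hy => simp only [map_add, hx, hy]
    | tmul b c => simp
  have h := hmul (Coalgebra.comul a)
  rw [lTensor_assocIncl_comul_eq_zero hΩ hτ hΔ hinv ha, map_zero, map_zero,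
    HopfAlgebra.mul_antipode_rTensor_comul_apply, AlgHom.commutes,
    ← AlgHom.commutes (assocMk hΩ hτ), assocMk_eq_zero_iff] at h
  by_contra ha0
  refine hne (LinearMap.ext fun ω => ?_)
  have hω := h ω
  rw [← Algebra.commutes, ← Algebra.smul_def, map_smul, smul_eq_mul] at hω
  exact (mul_eq_zero.mp hω).resolve_left ha0

include hΔ hinv in
/-- `I ∩ A = 0`: the slices `f(a₁) a₂` of an element `a` of `I ∩ A` lie in `I ∩ A`, where the
counit vanishes, so that `f(a) = f(a₁) e(a₂) = 0` for all functionals `f`. -/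
theorem assocIncl_injective (hne : τ ≠ 0) : Function.Injective (assocIncl hΩ hτ) := by
  rw [injective_iff_map_eq_zero]
  intro a ha
  rw [← Module.forall_dual_apply_eq_zero_iff ℂ a]
  intro f
  have hmem : assocIncl hΩ hτ (TensorProduct.lid ℂ A (f.rTensor A (Coalgebra.comul a))) = 0 := by
    have h := lid_rTensor_lTensor f (assocIncl hΩ hτ).toLinearMap (Coalgebra.comul a)
    rw [lTensor_assocIncl_comul_eq_zero hΩ hτ hΔ hinv ha, map_zero, map_zero] at h
    exact h.symm
  have hcounit : ∀ x : A ⊗[ℂ] A,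
      Coalgebra.counit (R := ℂ) (TensorProduct.lid ℂ A (f.rTensor A x)) =
        f (TensorProduct.rid ℂ A ((Coalgebra.counit (R := ℂ)).lTensor A x)) := by
    intro x
    induction x with
    | zero => simp
    | add x y hx hy => simp only [map_add, hx, hy]
    | tmul b c => simp [mul_comm]
  have h := counit_eq_zero_of_assocIncl_eq_zero hΩ hτ hΔ hinv hne hmem
  rwa [hcounit, Coalgebra.lTensor_counit_comul, TensorProduct.rid_tmul, one_smul] at h

end Quotient

end NCCalculus

end

theorem theorem4p12 {A : Type*} [Ring A] [HopfAlgebra ℂ A]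
    (h : A →ₗ[ℂ] ℂ) (hh : NCCalculus.IsHaarIntegral h) (N : ℕ)
    (τ : NCCalculus.UniversalForms A →ₗ[ℂ] ℂ)
    (hτ : NCCalculus.IsClosedTwistedGradedTrace (NCCalculus.UniversalForms.deg A)
      (NCCalculus.UniversalForms.d A) N τ)
    (hinv : NCCalculus.IsLeftInvariant (NCCalculus.universalCoaction A).toLinearMap τ)
    (hne : τ ≠ 0) :
    let hΩ := NCCalculus.UniversalForms.isDifferentialCalculus A
    (NCCalculus.IsDifferentialCalculus (NCCalculus.assocIncl hΩ hτ) (NCCalculus.assocDeg hΩ hτ)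
        (NCCalculus.assocD hΩ hτ) ∧
      NCCalculus.HasDimension (NCCalculus.assocDeg hΩ hτ) N) ∧
    NCCalculus.IsClosedTwistedGradedTrace (NCCalculus.assocDeg hΩ hτ) (NCCalculus.assocD hΩ hτ) N
      (NCCalculus.assocTrace hΩ hτ) ∧
    ∃ Δ : NCCalculus.AssocForms hΩ hτ →ₗ[ℂ] A ⊗[ℂ] NCCalculus.AssocForms hΩ hτ,
      NCCalculus.IsLeftCovariant (NCCalculus.assocIncl hΩ hτ) (NCCalculus.assocD hΩ hτ) Δ ∧
      NCCalculus.IsLeftInvariant Δ (NCCalculus.assocTrace hΩ hτ) := by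
  intro hΩ
  have hΔ := NCCalculus.isLeftCovariant_universalCoaction A
  exact ⟨⟨NCCalculus.isDifferentialCalculus_assoc hΩ hτ
        (NCCalculus.assocIncl_injective hΩ hτ hΔ hinv hne),
      NCCalculus.hasDimension_assoc hΩ hτ hne⟩,
    NCCalculus.isClosedTwistedGradedTrace_assoc hΩ hτ,
    NCCalculus.assocCoaction hΩ hτ hΔ hinv,
    NCCalculus.isLeftCovariant_assocCoaction hΩ hτ hΔ hinv,
    NCCalculus.isLeftInvariant_assocTrace hΩ hτ hΔ hinv⟩
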